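/- **Definitions.** Let $n,m,s,\alpha\ge 1$ and $b\ge 2$ be integers, let $0<\beta\le\min(1,\alpha m/n)$ be real and let $0\le t\le\beta n$ be an integer. For sets $I_1,\dots,I_s\subseteq\{1,\dots,n\}$, $I_j=\{i_{j,1}>\dots>i_{j,\nu_j}\}$ (possibly empty), and digits $a_{j,l}\in\{0,\dots,b-1\}$ for $l\in I_j$, the corresponding *generalised elementary interval in base $b$* is $$J=\prod_{j=1}^s\ \bigcup_{\substack{a_{j,l}\in\{0,\dots,b-1\}\\ l\in\{1,\dots,n\}\setminus I_j}}\Big[\tfrac{a_{j,1}}{b}+\dots+\tfrac{a_{j,n}}{b^n},\ \tfrac{a_{j,1}}{b}+\dots+\tfrac{a_{j,n}}{b^n}+\tfrac1{b^n}\Big).$$ A multiset $P=\{\boldsymbol x_0,\dots,\boldsymbol x_{b^m-1}\}$ of points of $[0,1)^s$ is a *$(t,\alpha,\beta,n,m,s)$-net in base $b$* if, for all $I_1,\dots,I_s$ with $\sum_{j=1}^s\sum_{l=1}^{\min(\nu_j,\alpha)}i_{j,l}\le\beta n-t$ and all choices of the prescribed digits, $J$ contains exactly $b^{\,m-\nu_1-\dots-\nu_s}$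 points of $P$, counted with multiplicity. **Theorem (Propagation Rule 17).** Let $b$ be a prime power, let $s'\ge 1$, and let $$\{\boldsymbol 0\}=\mathcal N'_0\subsetneq\mathcal N'_1\subsetneq\dots\subsetneq\mathcal N'_r=\mathbb F_b^{s'}$$ be a chain of linear subspaces. For $u=1,\dots,r$ put $e_u=\dim\mathcal N'_u-\dim\mathcal N'_{u-1}$ and let $\delta'_u$ be the minimum Hamming distance between two distinct elements of $\mathcal N'_u$. Let $\alpha\ge 1$ and let $1\le s_1\le s_2\le\dots\le s_r$ be integers. For $u=1,\dots,r$ let $\mathcal P_u$ be a (not necessarily digital) $(t_u,\alpha,\beta_u,n_u,m_u,s_u)$-net in base $b^{e_u}$. Put $$s=\sum_{u=1}^r e_us_u,\qquad m=\sum_{u=1}^r e_um_u,\qquad n=\sum_{u=1}^r e_un_u,\qquad \beta=\min(1,\alpha m/n).$$ Then there exists a $(t,\alpha,\beta,n,m,s)$-net in base $b$ with $$t\le\beta n+1-\min_{1\le u\le r}\big(\lfloor\beta_un_u\rfloor-t_u+1\big)\,\delta'_u .$$ -/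

import Mathlib

/-- The sum of the `min (#I) α` largest positions in `I`. An element `l : Fin n` stands for
the position `l + 1 ∈ {1, …, n}`; it is among the `α` largest elements of `I` iff fewer than `α`
elements of `I` exceed it. -/
def topSum {n : ℕ} (α : ℕ) (I : Finset (Fin n)) : ℕ :=
  ∑ l ∈ I with (I.filter (fun k => l < k)).card < α, ((l : ℕ) + 1)

/-- The generalised elementary interval in base `b` with prescribed digits `a j l` at the
positions `l ∈ I j`, the remaining ones of the first `n` digits being free. -/
def genElemInterval {b n s : ℕ} (I : Fin s → Finset (Fin n))
    (a : (j : Fin s) → {l : Fin n // l ∈ I j} → Fin b) : Set (Fin s → ℝ) :=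
  {x | ∀ j : Fin s, ∃ d : Fin n → Fin b,
    (∀ l : {l : Fin n // l ∈ I j}, d l.1 = a j l) ∧
    x j ∈ Set.Ico (∑ l : Fin n, ((d l : ℕ) : ℝ) / (b : ℝ) ^ ((l : ℕ) + 1))
      (∑ l : Fin n, ((d l : ℕ) : ℝ) / (b : ℝ) ^ ((l : ℕ) + 1) + 1 / (b : ℝ) ^ n)}

/-- The family `P` of `b ^ m` points (repetitions allowed) is a `(t, α, β, n, m, s)`-net in
base `b`. The last field says that each interval contains exactly `b ^ (m - ∑ j, #(I j))` points,
written without subtraction (so that it also forces `∑ j, #(I j) ≤ m`). -/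
structure IsHigherOrderNet (t α : ℕ) (β : ℝ) (n m s b : ℕ)
    (P : Fin (b ^ m) → Fin s → ℝ) : Prop where
  one_le_n : 1 ≤ n
  one_le_m : 1 ≤ m
  one_le_s : 1 ≤ s
  one_le_alpha : 1 ≤ α
  two_le_b : 2 ≤ b
  beta_pos : 0 < β
  beta_le : β ≤ min 1 ((α : ℝ) * m / n)
  t_le : (t : ℝ) ≤ β * n
  mem_unitCube : ∀ h j, P h j ∈ Set.Ico (0 : ℝ) 1
  card_eq : ∀ I : Fin s → Finset (Fin n),
    ((∑ j, topSum α (I j) : ℕ) : ℝ) ≤ β * n - t →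
    ∀ a : (j : Fin s) → {l : Fin n // l ∈ I j} → Fin b,
      Nat.card {h : Fin (b ^ m) // P h ∈ genElemInterval I a} * b ^ (∑ j, (I j).card) = b ^ m

/-! This is generalised concatenation of codes, with duality replaced by character sums because the
given nets need not be linear. Write F for the field with b elements. Linear maps Ψ_u detect each
step of the chain, and the new digits are F-linear combinations, with coefficients from Ψ_u, of the
F^{e_u}-valued digits of the given nets. The new points are indexed by tuples (h_u), so a character
sum over the new digits factors into one sum per given net (`sum_mul_combinedDigits`).

For a nonzero frequency k it suffices that one factor vanishes. Let u be the largest index at which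
some Ψ_u sees k. Then the vectors formed from k in the blocks of net u lie in the u-th space of the
chain, so each one seen by Ψ_u has Hamming weight at least δ'_u. By `exists_mul_topSum_le` the
frequency induced on net u therefore has weight at most 1/δ'_u times that of k. The choice of t puts
it within the range where net u is equidistributed, so its factor is zero. Fourier inversion
(`card_fiber_mul_of_sum_addChar_eq_zero`) turns vanishing sums back into exact counts. -/

/-! ### Weights of sets of digit positions -/

theorem topSum_succ {n : ℕ} (α : ℕ) (I : Finset (Fin n)) (hI : I.Nonempty) :
    topSum (α + 1) I = ((I.max' hI : ℕ) + 1) + topSum α (I.erase (I.max' hI)) := by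
  have hM := I.max'_mem hI
  have hle : ∀ k ∈ I, k ≤ I.max' hI := fun k hk => I.le_max' k hk
  generalize I.max' hI = M at hM hle
  have h : I.filter (fun l => (I.filter (fun k => l < k)).card < α + 1) =
      insert M ((I.erase M).filter
        (fun l => ((I.erase M).filter (fun k => l < k)).card < α)) := by
    ext l
    simp only [Finset.mem_filter, Finset.mem_insert, Finset.mem_erase]
    by_cases hl : l = M
    · subst hl
      have : I.filter (fun k => l < k) = ∅ :=
        Finset.filter_eq_empty_iff.2 fun k hk => not_lt.2 (hle k hk)
      simp [hM, this]
    · simp only [hl, not_false_eq_true, true_and, false_or, and_congr_right_iff, ne_eq]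
      intro hlI
      have hlt : l < M := lt_of_le_of_ne (hle l hlI) hl
      have : (I.erase M).filter (fun k => l < k) = (I.filter (fun k => l < k)).erase M := by
        ext k
        simp only [Finset.mem_filter, Finset.mem_erase, and_assoc]
      rw [this]
      have hc := Finset.card_erase_add_one
        (show M ∈ I.filter (fun k => l < k) from Finset.mem_filter.2 ⟨hM, hlt⟩)
      omega
  unfold topSum
  rw [h, Finset.sum_insert (by simp)]

/-- Greedy comparison: remove the maxima of `A` and `I` together and induct on `α`. Thus `topSum` is
a maximum over subsets of size at most `α`, which is how it gets bounded from below. -/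
theorem sum_le_topSum {n : ℕ} (α : ℕ) {I A : Finset (Fin n)} (hA : A ⊆ I)
    (hc : A.card ≤ α) : ∑ l ∈ A, ((l : ℕ) + 1) ≤ topSum α I := by
  induction α generalizing I A with
  | zero =>
    have : A = ∅ := Finset.card_eq_zero.1 (by omega)
    simp [this]
  | succ α ih =>
    rcases A.eq_empty_or_nonempty with rfl | hne
    · simp
    have hI := hne.mono hA
    rw [topSum_succ α I hI, ← Finset.add_sum_erase A _ (A.max'_mem hne)]
    have h1 : A.max' hne ≤ I.max' hI := Finset.max'_subset hne hA
    refine add_le_add (by simpa using h1) (ih ?_ ?_)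
    · intro x hx
      have hxA := Finset.mem_of_mem_erase hx
      have hlt : x < A.max' hne :=
        lt_of_le_of_ne (A.le_max' x hxA) (Finset.ne_of_mem_erase hx)
      exact Finset.mem_erase.2 ⟨(hlt.trans_le h1).ne, hA hxA⟩
    · have := Finset.card_erase_add_one (A.max'_mem hne)
      omega

/-- All other selected elements lie above the smallest selected one, which has fewer than `α`
elements of `I` above it. -/
theorem card_top_le {n : ℕ} (α : ℕ) (I : Finset (Fin n)) :
    (I.filter (fun l => (I.filter (fun k => l < k)).card < α)).card ≤ α := by
  set T := I.filter (fun l => (I.filter (fun k => l < k)).card < α) with hT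
  rcases T.eq_empty_or_nonempty with h | hne
  · simp [h]
  have hmin := T.min'_mem hne
  have h1 : T.erase (T.min' hne) ⊆ I.filter (fun k => T.min' hne < k) := by
    intro x hx
    have hxT := Finset.mem_of_mem_erase hx
    exact Finset.mem_filter.2 ⟨(Finset.mem_filter.1 hxT).1,
      lt_of_le_of_ne (T.min'_le x hxT) (Finset.ne_of_mem_erase hx).symm⟩
  have h2 := Finset.card_le_card h1
  have h3 := (Finset.mem_filter.1 hmin).2
  have h4 := Finset.card_erase_add_one hmin
  omega

/-- If every position of `C` lies in at least `δ` of the sets `I j`, then the weights of the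
`I j` add up to at least `δ` times the weight of `C`. -/
theorem mul_topSum_le_sum_topSum {ι : Type*} [Fintype ι] {n n' : ℕ} (hn : n' ≤ n) (α δ : ℕ)
    (C : Finset (Fin n')) (I : ι → Finset (Fin n))
    (h : ∀ l ∈ C, δ ≤ (Finset.univ.filter (fun j => Fin.castLE hn l ∈ I j)).card) :
    δ * topSum α C ≤ ∑ j, topSum α (I j) := by
  set T := C.filter (fun l => (C.filter (fun k => l < k)).card < α) with hT
  have hj : ∀ j, ∑ l ∈ T, (if Fin.castLE hn l ∈ I j then ((l : ℕ) + 1) else 0) ≤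
      topSum α (I j) := by
    intro j
    rw [← Finset.sum_filter]
    refine le_trans (le_of_eq ?_) (sum_le_topSum α
      (A := (T.filter (fun l => Fin.castLE hn l ∈ I j)).map (Fin.castLEEmb hn)) ?_ ?_)
    · simp
    · intro x hx
      obtain ⟨l, hl, rfl⟩ := Finset.mem_map.1 hx
      exact (Finset.mem_filter.1 hl).2
    · rw [Finset.card_map]
      exact (Finset.card_filter_le _ _).trans (card_top_le α C)
  -- Double counting of pairs (l, j) with l among the top α positions of `C` and in `I j`.
  calc δ * topSum α C = ∑ l ∈ T, δ * ((l : ℕ) + 1) := by rw [topSum, Finset.mul_sum]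
    _ ≤ ∑ l ∈ T, ∑ j, (if Fin.castLE hn l ∈ I j then ((l : ℕ) + 1) else 0) := by
        refine Finset.sum_le_sum fun l hl => ?_
        rw [← Finset.sum_filter, Finset.sum_const, smul_eq_mul]
        exact Nat.mul_le_mul_right _ (h l (Finset.mem_filter.1 hl).1)
    _ = ∑ j, ∑ l ∈ T, (if Fin.castLE hn l ∈ I j then ((l : ℕ) + 1) else 0) :=
        Finset.sum_comm
    _ ≤ _ := Finset.sum_le_sum fun j _ => hj j

theorem topSum_singleton {n α : ℕ} (hα : 1 ≤ α) (l : Fin n) : topSum α {l} = (l : ℕ) + 1 := by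
  have : ({l} : Finset (Fin n)).filter
      (fun l' => (({l} : Finset (Fin n)).filter (fun k => l' < k)).card < α) = {l} := by
    ext x
    simp only [Finset.mem_filter, Finset.mem_singleton, and_iff_left_iff_imp]
    rintro rfl
    simp [Finset.filter_singleton]
    omega
  rw [topSum, this, Finset.sum_singleton]

/-! ### Passing between points and digits -/

/-- The base `b` fraction with digits `d` as a fraction with denominator `b ^ n`. -/
theorem sum_digit_div_pow {b n : ℕ} (hb : 2 ≤ b) (d : Fin n → Fin b) :
    ∑ l : Fin n, ((d l : ℕ) : ℝ) / (b : ℝ) ^ ((l : ℕ) + 1) =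
      ((finFunctionFinEquiv (fun l => d l.rev) : ℕ) : ℝ) / (b : ℝ) ^ n := by
  have hb0 : (b : ℝ) ≠ 0 := by positivity
  rw [finFunctionFinEquiv_apply, Nat.cast_sum, Finset.sum_div,
    ← Equiv.sum_comp Fin.revPerm]
  refine Finset.sum_congr rfl fun l _ => ?_
  have hl : (l.rev : ℕ) + 1 + (l : ℕ) = n := by rw [Fin.val_rev]; omega
  simp only [Fin.revPerm_apply, Nat.cast_mul, Nat.cast_pow]
  rw [div_eq_div_iff (by positivity) (by positivity), mul_assoc, ← pow_add, add_comm (l : ℕ), hl]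

/-- The cells are the level sets of ⌊x bⁿ⌋. The reversal `Fin.rev` appears because
`finFunctionFinEquiv` puts the least significant digit first. -/
theorem mem_Ico_digits_iff {b n : ℕ} (hb : 2 ≤ b) (d : Fin n → Fin b) {x : ℝ} (hx : 0 ≤ x) :
    x ∈ Set.Ico (∑ l : Fin n, ((d l : ℕ) : ℝ) / (b : ℝ) ^ ((l : ℕ) + 1))
      (∑ l : Fin n, ((d l : ℕ) : ℝ) / (b : ℝ) ^ ((l : ℕ) + 1) + 1 / (b : ℝ) ^ n) ↔
    ⌊x * (b : ℝ) ^ n⌋₊ = (finFunctionFinEquiv (fun l => d l.rev) : ℕ) := by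
  have hbn : 0 < (b : ℝ) ^ n := by positivity
  rw [sum_digit_div_pow hb, Nat.floor_eq_iff (by positivity), ← add_div, Set.mem_Ico,
    div_le_iff₀ hbn, lt_div_iff₀ hbn]

theorem digits_unique {b n : ℕ} (hb : 2 ≤ b) {d d' : Fin n → Fin b} {x : ℝ} (hx : 0 ≤ x)
    (h : x ∈ Set.Ico (∑ l : Fin n, ((d l : ℕ) : ℝ) / (b : ℝ) ^ ((l : ℕ) + 1))
      (∑ l : Fin n, ((d l : ℕ) : ℝ) / (b : ℝ) ^ ((l : ℕ) + 1) + 1 / (b : ℝ) ^ n))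
    (h' : x ∈ Set.Ico (∑ l : Fin n, ((d' l : ℕ) : ℝ) / (b : ℝ) ^ ((l : ℕ) + 1))
      (∑ l : Fin n, ((d' l : ℕ) : ℝ) / (b : ℝ) ^ ((l : ℕ) + 1) + 1 / (b : ℝ) ^ n)) :
    d = d' := by
  rw [mem_Ico_digits_iff hb _ hx] at h h'
  have := finFunctionFinEquiv.injective (Fin.ext (h.symm.trans h'))
  ext l
  simpa using congrArg Fin.val (congrFun this l.rev)

theorem exists_digits {b n : ℕ} (hb : 2 ≤ b) {x : ℝ} (hx : x ∈ Set.Ico (0 : ℝ) 1) :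
    ∃ d : Fin n → Fin b,
      x ∈ Set.Ico (∑ l : Fin n, ((d l : ℕ) : ℝ) / (b : ℝ) ^ ((l : ℕ) + 1))
        (∑ l : Fin n, ((d l : ℕ) : ℝ) / (b : ℝ) ^ ((l : ℕ) + 1) + 1 / (b : ℝ) ^ n) := by
  have hbn : 0 < (b : ℝ) ^ n := by positivity
  have hlt : ⌊x * (b : ℝ) ^ n⌋₊ < b ^ n := by
    rw [Nat.floor_lt (mul_nonneg hx.1 hbn.le), Nat.cast_pow]
    exact mul_lt_of_lt_one_left hbn hx.2
  refine ⟨fun l => finFunctionFinEquiv.symm ⟨_, hlt⟩ l.rev, ?_⟩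
  rw [mem_Ico_digits_iff hb _ hx.1]
  simp only [Fin.rev_rev]
  have := congrArg Fin.val
    (finFunctionFinEquiv.apply_symm_apply (⟨⌊x * (b : ℝ) ^ n⌋₊, hlt⟩ : Fin (b ^ n)))
  exact this.symm

theorem mem_genElemInterval_iff {b n s : ℕ} (hb : 2 ≤ b) (I : Fin s → Finset (Fin n))
    (a : (j : Fin s) → {l : Fin n // l ∈ I j} → Fin b) {x : Fin s → ℝ} (hx : ∀ j, 0 ≤ x j)
    {D : Fin s → Fin n → Fin b}
    (hD : ∀ j, x j ∈ Set.Ico (∑ l : Fin n, ((D j l : ℕ) : ℝ) / (b : ℝ) ^ ((l : ℕ) + 1))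
        (∑ l : Fin n, ((D j l : ℕ) : ℝ) / (b : ℝ) ^ ((l : ℕ) + 1) + 1 / (b : ℝ) ^ n)) :
    x ∈ genElemInterval I a ↔ ∀ j, ∀ l : {l : Fin n // l ∈ I j}, D j l = a j l := by
  refine ⟨fun h j => ?_, fun h j => ⟨D j, h j, hD j⟩⟩
  obtain ⟨d, hd, hdx⟩ := h j
  rw [digits_unique hb (hx j) (hD j) hdx]
  exact hd

/-- The digits of the points of a net, over an arbitrary alphabet of the right size. -/
theorem IsHigherOrderNet.exists_digits {t α n m s b : ℕ} {β : ℝ} {P : Fin (b ^ m) → Fin s → ℝ}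
    (hP : IsHigherOrderNet t α β n m s b P) {A : Type*} (ε : Fin b ≃ A) :
    ∃ D : Fin (b ^ m) → Fin s → Fin n → A, ∀ I : Fin s → Finset (Fin n),
      ((∑ j, topSum α (I j) : ℕ) : ℝ) ≤ β * n - t →
      ∀ a : (j : Fin s) → {l : Fin n // l ∈ I j} → A,
        Nat.card {h // ∀ j, ∀ l : {l : Fin n // l ∈ I j}, D h j l = a j l} *
          b ^ (∑ j, (I j).card) = b ^ m := by
  choose D hD using fun h j => _root_.exists_digits (n := n) hP.two_le_b (hP.mem_unitCube h j)
  refine ⟨fun h j l => ε (D h j l), fun I hI a => ?_⟩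
  refine Eq.trans ?_ (hP.card_eq I hI fun j l => ε.symm (a j l))
  congr 1
  refine Nat.card_congr (Equiv.subtypeEquivRight fun h => ?_)
  rw [mem_genElemInterval_iff hP.two_le_b I _ (fun j => (hP.mem_unitCube h j).1) (hD h)]
  simp only [Equiv.eq_symm_apply]

/-- A net from its digits. -/
theorem exists_isHigherOrderNet_of_digits {t α n m s b : ℕ} {β : ℝ} (hn : 1 ≤ n) (hm : 1 ≤ m)
    (hs : 1 ≤ s) (hα : 1 ≤ α) (hb : 2 ≤ b) (hβ : 0 < β) (hβ' : β ≤ min 1 ((α : ℝ) * m / n))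
    (ht : (t : ℝ) ≤ β * n) {A H σ : Type*} [Fintype σ] (ε : Fin b ≃ A)
    (εH : Fin (b ^ m) ≃ H) (εσ : Fin s ≃ σ) (D : H → σ → Fin n → A)
    (hD : ∀ I : σ → Finset (Fin n), ((∑ p, topSum α (I p) : ℕ) : ℝ) ≤ β * n - t →
      ∀ a : (p : σ) → {l : Fin n // l ∈ I p} → A,
        Nat.card {h // ∀ p, ∀ l : {l : Fin n // l ∈ I p}, D h p l = a p l} *
          b ^ (∑ p, (I p).card) = b ^ m) :
    ∃ Q : Fin (b ^ m) → Fin s → ℝ, IsHigherOrderNet t α β n m s b Q := by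
  have hbn : 0 < (b : ℝ) ^ n := by positivity
  let d : Fin (b ^ m) → Fin s → Fin n → Fin b := fun h j l => ε.symm (D (εH h) (εσ j) l)
  -- Each point is the left endpoint of the cell with the given digits.
  let Q : Fin (b ^ m) → Fin s → ℝ := fun h j =>
    ∑ l : Fin n, ((d h j l : ℕ) : ℝ) / (b : ℝ) ^ ((l : ℕ) + 1)
  have h0 : ∀ h j, 0 ≤ Q h j := fun h j => Finset.sum_nonneg fun l _ => by positivity
  refine ⟨Q, hn, hm, hs, hα, hb, hβ, hβ', ht, fun h j => ⟨h0 h j, ?_⟩, fun I hI a => ?_⟩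
  · simp only [Q]
    rw [sum_digit_div_pow hb, div_lt_one hbn]
    exact_mod_cast Fin.is_lt _
  · have hI' : ((∑ p, topSum α (I (εσ.symm p)) : ℕ) : ℝ) ≤ β * n - t := by
      rwa [Equiv.sum_comp εσ.symm fun j => topSum α (I j)]
    have key := hD (fun p => I (εσ.symm p)) hI' fun p l => ε (a (εσ.symm p) l)
    rw [Equiv.sum_comp εσ.symm fun j => (I j).card] at key
    refine Eq.trans ?_ key
    congr 1
    refine Nat.card_congr (Equiv.subtypeEquiv εH fun h => ?_)
    rw [mem_genElemInterval_iff hb I a (h0 h) (D := d h)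
      (fun j => ⟨le_rfl, lt_add_of_pos_right _ (by positivity)⟩)]
    rw [← εσ.symm.forall_congr_right]
    simp only [d, Equiv.apply_symm_apply, Equiv.symm_apply_eq]

/-! ### Character sums and equidistribution -/

theorem sum_addChar_linearMap_eq_zero {F V : Type*} [Field F] [AddCommGroup V] [Module F V]
    [Fintype V] {ψ : AddChar F ℂ} (hψ : ψ ≠ 1) {f : V →ₗ[F] F} (hf : f ≠ 0) :
    ∑ v, ψ (f v) = 0 := by
  have h : ψ.compAddMonoidHom f.toAddMonoidHom ≠ 1 := by
    obtain ⟨x, hx⟩ := AddChar.ne_one_iff.1 hψ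
    obtain ⟨v, hv⟩ := LinearMap.surjective hf x
    refine AddChar.ne_one_iff.2 ⟨v, ?_⟩
    simpa [hv] using hx
  simpa using AddChar.sum_eq_zero_of_ne_one h

theorem sum_comp_eq_of_card_fiber {H V : Type*} [Fintype H] [Fintype V] (X : H → V) (N : ℕ)
    (hX : ∀ v, Nat.card {h // X h = v} = N) (g : V → ℂ) :
    ∑ h, g (X h) = N * ∑ v, g v := by
  classical
  rw [← Finset.sum_fiberwise Finset.univ X fun h => g (X h), Finset.mul_sum]
  refine Finset.sum_congr rfl fun v _ => ?_
  rw [Finset.sum_congr rfl fun h hh => by rw [(Finset.mem_filter.1 hh).2], Finset.sum_const,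
    nsmul_eq_mul, ← hX v, Nat.card_eq_fintype_card, Fintype.card_subtype]

/-- If the digits at the positions where `c` does not vanish are equidistributed, then the
character sum with frequency `c ≠ 0` vanishes. -/
theorem sum_addChar_eq_zero_of_equidistributed {F : Type*} [Field F] [Fintype F]
    {ψ : AddChar F ℂ} (hψ : ψ ≠ 1) {H τ κ ε : Type*} [Fintype H] [Fintype τ] [Fintype κ]
    [Fintype ε] (D : H → τ → κ → ε → F) (c : τ → κ → ε → F) (hc : c ≠ 0)
    (I : τ → Finset κ) (hI : ∀ i l, l ∉ I i → c i l = 0) (N : ℕ)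
    (hD : ∀ a : (i : τ) → {l // l ∈ I i} → ε → F,
      Nat.card {h // ∀ i, ∀ l : {l // l ∈ I i}, D h i l = a i l} = N) :
    ∑ h, ψ (∑ i, ∑ l, c i l ⬝ᵥ D h i l) = 0 := by
  classical
  let f : ((i : τ) → {l // l ∈ I i} → ε → F) →ₗ[F] F :=
    { toFun := fun a => ∑ i, ∑ l : {l // l ∈ I i}, c i l ⬝ᵥ a i l
      map_add' := fun a a' => by simp [dotProduct_add, Finset.sum_add_distrib]
      map_smul' := fun x a => by simp [dotProduct_smul, Finset.mul_sum] }
  have hfa : ∀ a, f a = ∑ i, ∑ l : {l // l ∈ I i}, c i l ⬝ᵥ a i l := fun a => rfl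
  have hf : f ≠ 0 := by
    intro h0
    apply hc
    funext i l
    by_cases hl : l ∈ I i
    · funext j
      have := LinearMap.congr_fun h0 (Pi.single i (Pi.single ⟨l, hl⟩ (Pi.single j 1)))
      rw [hfa, Finset.sum_eq_single i, Finset.sum_eq_single ⟨l, hl⟩] at this
      · simpa using this
      · intro l' _ hl'
        simp [hl']
      · simp
      · intro i' _ hi'
        simp [hi']
      · simp
    · exact hI i l hl
  have key := sum_comp_eq_of_card_fiber (fun h => fun i (l : {l // l ∈ I i}) => D h i l) N
    (fun a => by simpa [funext_iff] using hD a) (fun a => ψ (f a))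
  rw [sum_addChar_linearMap_eq_zero hψ hf, mul_zero] at key
  rw [← key]
  refine Finset.sum_congr rfl fun h _ => ?_
  rw [hfa]
  congr 1
  refine Finset.sum_congr rfl fun i _ => ?_
  rw [Finset.sum_coe_sort (I i) fun l => c i l ⬝ᵥ D h i l]
  refine (Finset.sum_subset (Finset.subset_univ _) fun l _ hl => ?_).symm
  rw [hI i l hl, zero_dotProduct]

/-- A map all of whose nontrivial character sums vanish is equidistributed. -/
theorem card_fiber_mul_of_sum_addChar_eq_zero {F : Type*} [Field F] [Fintype F]
    {ψ : AddChar F ℂ} (hψ : ψ ≠ 1) {H J : Type*} [Fintype H] [Fintype J] (X : H → J → F)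
    (hX : ∀ k : J → F, k ≠ 0 → ∑ h, ψ (k ⬝ᵥ X h) = 0) (a : J → F) :
    Nat.card {h // X h = a} * Fintype.card F ^ Fintype.card J = Fintype.card H := by
  classical
  -- The double sum is evaluated in both orders: over `h` first only k = 0 survives, over `k` first
  -- only the points with X h = a do.
  have h1 : ∑ k : J → F, ∑ h, ψ (k ⬝ᵥ (X h - a)) = Fintype.card H := by
    rw [Finset.sum_eq_single 0]
    · simp
    · intro k _ hk
      simp only [dotProduct_sub]
      simp only [sub_eq_add_neg, AddChar.map_add_eq_mul]
      rw [← Finset.sum_mul, hX k hk, zero_mul]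
    · simp
  have h2 : ∀ h, ∑ k : J → F, ψ (k ⬝ᵥ (X h - a)) =
      if X h = a then (Fintype.card F : ℂ) ^ Fintype.card J else 0 := by
    intro h
    split_ifs with hh
    · simp [hh]
    · have := sum_addChar_linearMap_eq_zero hψ (f := (dotProductBilin F F).flip (X h - a)) (by
        intro h0
        apply hh
        rw [← sub_eq_zero]
        funext j
        simpa using LinearMap.congr_fun h0 (Pi.single j 1))
      simpa using this
  rw [Finset.sum_comm, Finset.sum_congr rfl fun h _ => h2 h, ← Finset.sum_filter,
    Finset.sum_const, nsmul_eq_mul, ← Fintype.card_subtype, ← Nat.card_eq_fintype_card] at h1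
  exact_mod_cast h1

theorem card_digits_mul_of_sum_addChar_eq_zero {F : Type*} [Field F] [Fintype F]
    {ψ : AddChar F ℂ} (hψ : ψ ≠ 1) {H σ κ : Type*} [Fintype H] [Fintype σ] [Fintype κ]
    (D : H → σ → κ → F) (I : σ → Finset κ)
    (hD : ∀ k : σ → κ → F, k ≠ 0 → (∀ p l, l ∉ I p → k p l = 0) →
      ∑ h, ψ (∑ p, ∑ l, k p l * D h p l) = 0)
    (a : (p : σ) → {l // l ∈ I p} → F) :
    Nat.card {h // ∀ p, ∀ l : {l // l ∈ I p}, D h p l = a p l} *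
      Fintype.card F ^ (∑ p, (I p).card) = Fintype.card H := by
  classical
  have key := card_fiber_mul_of_sum_addChar_eq_zero hψ
    (fun h (q : Σ p, {l // l ∈ I p}) => D h q.1 q.2) (fun k hk => ?_) (fun q => a q.1 q.2)
  · rw [← key]
    congr 1
    · refine Nat.card_congr (Equiv.subtypeEquivRight fun h => ?_)
      simp [funext_iff, Sigma.forall]
    · simp
  · have := hD (fun p l => if hl : l ∈ I p then k ⟨p, l, hl⟩ else 0) (fun h0 => hk ?_)
      (fun p l hl => by simp [hl])
    · rw [← this]
      refine Finset.sum_congr rfl fun h _ => ?_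
      congr 1
      rw [dotProduct, Fintype.sum_sigma]
      refine Finset.sum_congr rfl fun p _ => ?_
      rw [← Finset.sum_subset (Finset.subset_univ (I p)) fun l _ hl => by simp [hl],
        ← Finset.sum_coe_sort (I p)]
      refine Finset.sum_congr rfl fun l _ => ?_
      simp
    · funext q
      simpa using congrFun (congrFun h0 q.1) q.2

/-! ### Linear algebra of the chain -/

/-- A linear map to coordinate space that exhibits `U` inside `V`. -/
theorem Submodule.exists_linearMap_ker {F E : Type*} [Field F] [AddCommGroup E] [Module F E]
    [FiniteDimensional F E] {U V : Submodule F E} (hUV : U ≤ V) {e : ℕ}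
    (he : Module.finrank F V = Module.finrank F U + e) :
    ∃ f : E →ₗ[F] (Fin e → F), ∀ x ∈ V, f x = 0 → x ∈ U := by
  let U' := U.comap V.subtype
  have h1 : Module.finrank F (V ⧸ U') = e := by
    have h2 := U'.finrank_quotient_add_finrank
    have h3 : Module.finrank F U' = Module.finrank F U :=
      (Submodule.comapSubtypeEquivOfLe hUV).finrank_eq
    omega
  let φ : (V ⧸ U') ≃ₗ[F] (Fin e → F) := LinearEquiv.ofFinrankEq _ _ (by simp [h1])
  -- The values outside `V` are arbitrary; only the kernel on `V` matters.
  obtain ⟨f, hf⟩ := LinearMap.exists_extend (φ.toLinearMap.comp U'.mkQ)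
  refine ⟨f, fun x hx h0 => ?_⟩
  have := LinearMap.congr_fun hf ⟨x, hx⟩
  simp only [LinearMap.comp_apply, Submodule.subtype_apply, h0, LinearEquiv.coe_coe,
    Submodule.mkQ_apply] at this
  have := (Submodule.Quotient.mk_eq_zero U').1 (φ.map_eq_zero_iff.1 this.symm)
  simpa [U'] using this

/-- A coordinate subspace complementary to a given subspace. -/
theorem Submodule.exists_coordinate_complement {F : Type*} [Field F] {s : ℕ}
    (K : Submodule F (Fin s → F)) :
    ∃ S : Finset (Fin s), S.card + Module.finrank F K = s ∧
      ∀ k ∈ K, (∀ j, j ∉ S → k j = 0) → k = 0 := by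
  classical
  let v : Fin s → (Fin s → F) ⧸ K := fun j => K.mkQ (Pi.single j 1)
  -- `S` indexes unit vectors whose images form a basis of the quotient by `K`.
  obtain ⟨κ, a, ha, hsp, hli⟩ := exists_linearIndependent' F v
  have : Fintype κ := Fintype.ofInjective a ha
  have hv : Submodule.span F (Set.range v) = ⊤ := by
    have : Set.range v = K.mkQ '' Set.range (Pi.basisFun F (Fin s)) := by
      rw [← Set.range_comp]
      congr 1
      funext j
      simp [v]
    rw [this, Submodule.span_image, (Pi.basisFun F (Fin s)).span_eq, Submodule.map_top,
      Submodule.range_mkQ]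
  have hcard : Fintype.card κ = Module.finrank F ((Fin s → F) ⧸ K) :=
    (Module.finrank_eq_card_basis (Module.Basis.mk hli (by rw [hsp, hv]))).symm
  refine ⟨Finset.univ.map ⟨a, ha⟩, ?_, fun k hk h0 => ?_⟩
  · rw [Finset.card_map, Finset.card_univ, hcard, K.finrank_quotient_add_finrank,
      Module.finrank_fin_fun]
  · have h1 : k = ∑ i, k (a i) • Pi.single (a i) (1 : F) := by
      funext j
      by_cases hj : j ∈ Finset.univ.map ⟨a, ha⟩
      · obtain ⟨i, -, rfl⟩ := Finset.mem_map.1 hj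
        rw [Finset.sum_apply, Finset.sum_eq_single i]
        · simp
        · intro i' _ hi'
          simp [ha.ne hi'.symm]
        · simp
      · rw [h0 j hj, Finset.sum_apply]
        refine (Finset.sum_eq_zero fun i _ => ?_).symm
        have : j ≠ a i := fun h => hj (Finset.mem_map.2 ⟨i, Finset.mem_univ _, h.symm⟩)
        simp [this]
    have h2 : ∑ i, k (a i) • (v ∘ a) i = 0 := by
      have := (Submodule.Quotient.mk_eq_zero K).2 hk
      rw [← Submodule.mkQ_apply, h1, map_sum] at this
      simpa [v] using this
    have h3 := Fintype.linearIndependent_iff.1 hli _ h2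
    rw [h1]
    exact Finset.sum_eq_zero fun i _ => by rw [h3 i, zero_smul]

section Chain

variable {F : Type*} [Field F] {r s' : ℕ} {N' : Fin (r + 1) → Submodule F (Fin s' → F)}
  {e : Fin r → ℕ}

theorem finrank_chain (hN'_zero : N' 0 = ⊥)
    (he : ∀ u : Fin r,
      Module.finrank F (N' u.succ) = Module.finrank F (N' u.castSucc) + e u)
    (k : Fin (r + 1)) :
    Module.finrank F (N' k) = ∑ u : Fin r, if (u : ℕ) < k then e u else 0 := by
  induction k using Fin.induction with
  | zero => simp [hN'_zero]
  | succ k ih =>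
    have h : ∀ u : Fin r, (if (u : ℕ) < k.succ then e u else 0) =
        (if (u : ℕ) < k.castSucc then e u else 0) + if u = k then e u else 0 := by
      intro u
      simp only [Fin.val_succ, Fin.val_castSucc, Fin.ext_iff]
      split_ifs <;> omega
    rw [he, ih, Finset.sum_congr rfl fun u _ => h u, Finset.sum_add_distrib]
    simp

/-- Descend from the full space: each vanishing Ψ_v lowers membership by one step of the chain. -/
theorem mem_chain_of_forall_eq_zero (hN'_last : N' (Fin.last r) = ⊤)
    {Ψ : (u : Fin r) → (Fin s' → F) →ₗ[F] (Fin (e u) → F)}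
    (hΨ : ∀ u, ∀ x ∈ N' u.succ, Ψ u x = 0 → x ∈ N' u.castSucc) (x : Fin s' → F)
    (k : Fin (r + 1)) (hx : ∀ v : Fin r, (k : ℕ) ≤ v → Ψ v x = 0) : x ∈ N' k := by
  induction k using Fin.reverseInduction with
  | last => simp [hN'_last]
  | cast k ih =>
    refine hΨ k x (ih fun v hv => hx v ?_) (hx k le_rfl)
    simp only [Fin.val_succ, Fin.val_castSucc] at hv ⊢
    omega

/-- A monotone sequence passes the level `i` at a definite index. -/
theorem exists_threshold {sᵤ : Fin r → ℕ} (hs : Monotone sᵤ) (i : ℕ) :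
    ∃ k : Fin (r + 1), ∀ u : Fin r, i < sᵤ u ↔ (k : ℕ) ≤ u := by
  by_cases h : ∃ u, i < sᵤ u
  · obtain ⟨u, hu, hmin⟩ := WellFounded.has_min (wellFounded_lt (α := Fin r)) {u | i < sᵤ u} h
    refine ⟨u.castSucc, fun v => ⟨fun hv => not_lt.1 (hmin v hv), fun hv => ?_⟩⟩
    exact lt_of_lt_of_le hu (hs hv)
  · push Not at h
    refine ⟨Fin.last r, fun u => ⟨fun hu => absurd (h u) (not_le.2 hu), fun hu => ?_⟩⟩
    exact absurd u.2 (not_lt.2 hu)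

/-- The vector with coordinates `k ⟨i, j⟩` at `j ∈ S i`, and zero elsewhere. -/
def blockVector {T : ℕ} {S : Fin T → Finset (Fin s')} {κ : Type*}
    (k : (Σ i, {j // j ∈ S i}) → κ → F) (i : Fin T) (l : κ) : Fin s' → F :=
  ∑ j : {j // j ∈ S i}, k ⟨i, j⟩ l • Pi.single (j : Fin s') (1 : F)

theorem blockVector_apply_mem {T : ℕ} {S : Fin T → Finset (Fin s')} {κ : Type*}
    (k : (Σ i, {j // j ∈ S i}) → κ → F) (i : Fin T) (l : κ) (j : {j // j ∈ S i}) :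
    blockVector k i l j = k ⟨i, j⟩ l := by
  rw [blockVector, Finset.sum_apply, Finset.sum_eq_single j]
  · simp
  · intro j' _ hj'
    have : (j : Fin s') ≠ j' := fun h => hj' (Subtype.ext h).symm
    simp [this]
  · simp

theorem blockVector_apply_notMem {T : ℕ} {S : Fin T → Finset (Fin s')} {κ : Type*}
    (k : (Σ i, {j // j ∈ S i}) → κ → F) (i : Fin T) (l : κ) {j : Fin s'} (hj : j ∉ S i) :
    blockVector k i l j = 0 := by
  rw [blockVector, Finset.sum_apply]
  refine Finset.sum_eq_zero fun j' _ => ?_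
  have : j ≠ j' := fun h => hj (h ▸ j'.2)
  simp [this]

/-- The weight estimate for generalised concatenation. -/
theorem exists_mul_topSum_le [DecidableEq F] (hN'_last : N' (Fin.last r) = ⊤)
    {Ψ : (u : Fin r) → (Fin s' → F) →ₗ[F] (Fin (e u) → F)}
    (hΨ : ∀ u, ∀ x ∈ N' u.succ, Ψ u x = 0 → x ∈ N' u.castSucc)
    {δ' : Fin r → ℕ} (hδ' : ∀ u, ∀ x ∈ N' u.succ, x ≠ 0 → δ' u ≤ hammingNorm x)
    {sᵤ : Fin r → ℕ} (hs : Monotone sᵤ) {T : ℕ} {S : Fin T → Finset (Fin s')}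
    {K : Fin T → Fin (r + 1)} (hK : ∀ (i : Fin T) (u : Fin r), (i : ℕ) < sᵤ u ↔ (K i : ℕ) ≤ u)
    (hS : ∀ i, ∀ x ∈ N' (K i), (∀ j, j ∉ S i → x j = 0) → x = 0)
    {n : ℕ} (α : ℕ) (I : (Σ i, {j // j ∈ S i}) → Finset (Fin n))
    {k : (Σ i, {j // j ∈ S i}) → Fin n → F} (hk : k ≠ 0)
    (hkI : ∀ p l, l ∉ I p → k p l = 0) :
    ∃ u, (∃ (i : Fin T) (l : Fin n), (i : ℕ) < sᵤ u ∧ Ψ u (blockVector k i l) ≠ 0) ∧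
      ∀ i : Fin T, (i : ℕ) < sᵤ u → ∀ (n' : ℕ) (hn : n' ≤ n) (C : Finset (Fin n')),
        (∀ l ∈ C, Ψ u (blockVector k i (Fin.castLE hn l)) ≠ 0) →
        δ' u * topSum α C ≤ ∑ j, topSum α (I ⟨i, j⟩) := by
  classical
  -- The indices at which some Ψ_u detects `k`; the largest one is used.
  let A : Finset (Fin r) := Finset.univ.filter fun u =>
    ∃ (i : Fin T) (l : Fin n), (i : ℕ) < sᵤ u ∧ Ψ u (blockVector k i l) ≠ 0
  have hA : A.Nonempty := by
    by_contra hA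
    apply hk
    -- If nothing is detected, every block vector lies in `N' (K i)` and is supported on `S i`, a
    -- complement, so it vanishes.
    have h0 : ∀ i l, blockVector k i l = 0 := by
      intro i l
      refine hS i _ (mem_chain_of_forall_eq_zero hN'_last hΨ _ _ fun v hv => ?_)
        fun j hj => blockVector_apply_notMem k i l hj
      by_contra hne
      exact hA ⟨v, Finset.mem_filter.2 ⟨Finset.mem_univ _, i, l, (hK i v).2 hv, hne⟩⟩
    funext ⟨i, j⟩ l
    rw [← blockVector_apply_mem k, h0]
    rfl
  refine ⟨A.max' hA, (Finset.mem_filter.1 (A.max'_mem hA)).2, fun i hi n' hn C hC => ?_⟩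
  have hmax : ∀ v, A.max' hA < v → v ∉ A := fun v hv hvA => not_le.2 hv (A.le_max' v hvA)
  generalize A.max' hA = u at hi hC hmax ⊢
  refine mul_topSum_le_sum_topSum hn α _ C _ fun l hl => ?_
  have hne := hC l hl
  set x := blockVector k i (Fin.castLE hn l) with hx
  -- Monotonicity of `sᵤ` keeps block `i` active for all v > u, where maximality of `u` forces Ψ_v x
  -- = 0.
  have hxN : x ∈ N' u.succ := by
    refine mem_chain_of_forall_eq_zero hN'_last hΨ _ _ fun v hv => ?_
    have huv : u < v := by
      rw [Fin.val_succ] at hv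
      exact Fin.lt_def.2 hv
    by_contra hvne
    exact hmax v huv (Finset.mem_filter.2
      ⟨Finset.mem_univ _, i, _, lt_of_lt_of_le hi (hs huv.le), hvne⟩)
  have hx0 : x ≠ 0 := fun h => hne (by rw [h, map_zero])
  refine (hδ' u x hxN hx0).trans ?_
  rw [hammingNorm, ← Finset.card_map (Function.Embedding.subtype _)]
  refine Finset.card_le_card fun j hj => ?_
  have hj := (Finset.mem_filter.1 hj).2
  have hjS : j ∈ S i := by
    by_contra h
    exact hj (blockVector_apply_notMem k i _ h)
  refine Finset.mem_map.2 ⟨⟨j, hjS⟩, Finset.mem_filter.2 ⟨Finset.mem_univ _, ?_⟩, rfl⟩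
  by_contra h
  apply hj
  rw [hx, blockVector_apply_mem k i _ ⟨j, hjS⟩]
  exact hkI _ _ h

/-- Digits of the combined net: in position `⟨i, j⟩` the digit vectors of the given nets are
combined with the matrices of `Ψ`, padded by zero where they are not defined. -/
def combinedDigits {T n : ℕ} {S : Fin T → Finset (Fin s')} {sᵤ nᵤ : Fin r → ℕ}
    {H : Fin r → Type*} (Ψ : (u : Fin r) → (Fin s' → F) →ₗ[F] (Fin (e u) → F))
    (D : (u : Fin r) → H u → Fin (sᵤ u) → Fin (nᵤ u) → Fin (e u) → F)
    (h : (u : Fin r) → H u) (p : Σ i, {j // j ∈ S i}) (l : Fin n) : F :=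
  ∑ u, Ψ u (Pi.single (p.2 : Fin s') 1) ⬝ᵥ
    if hi : (p.1 : ℕ) < sᵤ u ∧ (l : ℕ) < nᵤ u then D u (h u) ⟨p.1, hi.1⟩ ⟨l, hi.2⟩ else 0

/-- Linearity of Ψ_u moves the frequency inside it, and the padding zeros drop out; the sum is then
separated by net. -/
theorem sum_mul_combinedDigits {T n : ℕ} {S : Fin T → Finset (Fin s')} {sᵤ nᵤ : Fin r → ℕ}
    (hsT : ∀ u, sᵤ u ≤ T) (hn : ∀ u, nᵤ u ≤ n)
    {H : Fin r → Type*} (Ψ : (u : Fin r) → (Fin s' → F) →ₗ[F] (Fin (e u) → F))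
    (D : (u : Fin r) → H u → Fin (sᵤ u) → Fin (nᵤ u) → Fin (e u) → F)
    (h : (u : Fin r) → H u) (k : (Σ i, {j // j ∈ S i}) → Fin n → F) :
    ∑ p, ∑ l, k p l * combinedDigits Ψ D h p l =
      ∑ u, ∑ i : Fin (sᵤ u), ∑ l : Fin (nᵤ u),
        Ψ u (blockVector k (Fin.castLE (hsT u) i) (Fin.castLE (hn u) l)) ⬝ᵥ D u (h u) i l := by
  have h1 : ∀ u, ∑ i : Fin (sᵤ u), ∑ l : Fin (nᵤ u),
        Ψ u (blockVector k (Fin.castLE (hsT u) i) (Fin.castLE (hn u) l)) ⬝ᵥ D u (h u) i l =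
      ∑ i : Fin T, ∑ l : Fin n, Ψ u (blockVector k i l) ⬝ᵥ
        if hi : (i : ℕ) < sᵤ u ∧ (l : ℕ) < nᵤ u then D u (h u) ⟨i, hi.1⟩ ⟨l, hi.2⟩ else 0 := by
    intro u
    refine Fintype.sum_of_injective (Fin.castLE (hsT u)) (Fin.castLE_injective _) _ _ ?_
      fun i => ?_
    · intro i hi
      have hi' : ¬ (i : ℕ) < sᵤ u := fun hlt => hi ⟨⟨i, hlt⟩, rfl⟩
      simp [hi']
    · refine Fintype.sum_of_injective (Fin.castLE (hn u)) (Fin.castLE_injective _) _ _ ?_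
        fun l => by simp
      intro l hl
      have hl' : ¬ (l : ℕ) < nᵤ u := fun hlt => hl ⟨⟨l, hlt⟩, rfl⟩
      simp [hl']
  simp only [h1, Fintype.sum_sigma, combinedDigits, Finset.mul_sum]
  symm
  rw [Finset.sum_comm]
  refine Finset.sum_congr rfl fun i _ => ?_
  rw [Finset.sum_congr rfl fun u _ => Finset.sum_congr rfl fun l _ => by
    rw [blockVector, map_sum, sum_dotProduct]]
  simp only [map_smul, smul_dotProduct, smul_eq_mul]
  refine Finset.sum_comm.trans ?_
  exact (Finset.sum_congr rfl fun l _ => Finset.sum_comm).trans Finset.sum_comm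

end Chain

/-! ### The combined net -/

theorem mainTheorem2 {F : Type*} [Field F] [Fintype F] [DecidableEq F]
    (b : ℕ) (hb : Fintype.card F = b)
    -- the chain of inner spaces, the dimension jumps and the minimum distances
    (r s' : ℕ) (hs' : 1 ≤ s')
    (N' : Fin (r + 1) → Submodule F (Fin s' → F))
    (hN'_strict : StrictMono N') (hN'_zero : N' 0 = ⊥) (hN'_last : N' (Fin.last r) = ⊤)
    (e δ' : Fin r → ℕ)
    (he : ∀ u : Fin r,
      Module.finrank F (N' u.succ) = Module.finrank F (N' u.castSucc) + e u)
    (hδ' : ∀ u : Fin r, IsLeast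
      {d : ℕ | ∃ x ∈ N' u.succ, ∃ y ∈ N' u.succ, x ≠ y ∧ hammingDist x y = d} (δ' u))
    -- the given nets in bases `b ^ e u`
    (α : ℕ) (hα : 1 ≤ α)
    (sᵤ : Fin r → ℕ) (hsᵤ_pos : ∀ u, 1 ≤ sᵤ u) (hsᵤ_mono : Monotone sᵤ)
    (tᵤ nᵤ mᵤ : Fin r → ℕ) (βᵤ : Fin r → ℝ)
    (P : (u : Fin r) → Fin ((b ^ e u) ^ mᵤ u) → Fin (sᵤ u) → ℝ)
    (hP : ∀ u, IsHigherOrderNet (tᵤ u) α (βᵤ u) (nᵤ u) (mᵤ u) (sᵤ u) (b ^ e u) (P u))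
    -- the parameters of the new net
    (s m n : ℕ) (hs : s = ∑ u, e u * sᵤ u) (hm : m = ∑ u, e u * mᵤ u)
    (hn : n = ∑ u, e u * nᵤ u)
    (β : ℝ) (hβ : β = min 1 ((α : ℝ) * m / n)) :
    ∃ (t : ℕ) (Q : Fin (b ^ m) → Fin s → ℝ),
      (t : ℝ) ≤ β * n + 1 - ⨅ u : Fin r, ((⌊βᵤ u * nᵤ u⌋ : ℝ) - tᵤ u + 1) * δ' u ∧
      IsHigherOrderNet t α β n m s b Q := by
  classical
  have hb2 : 2 ≤ b := hb ▸ Fintype.one_lt_card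
  have he1 : ∀ u, 1 ≤ e u := by
    intro u
    have h := Submodule.finrank_lt_finrank_of_lt (hN'_strict (Fin.castSucc_lt_succ (i := u)))
    have := he u
    omega
  have hr : 0 < r := by
    rcases Nat.eq_zero_or_pos r with rfl | h
    · have h0 : (⊥ : Submodule F (Fin s' → F)) = ⊤ := by
        rw [← hN'_zero, ← hN'_last]
        rfl
      have h1 := congrArg (fun U : Submodule F (Fin s' → F) => Module.finrank F U) h0
      simp only [finrank_bot, finrank_top, Module.finrank_fin_fun] at h1
      omega
    · exact h
  let w : Fin r := ⟨r - 1, by omega⟩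
  have hw : w.succ = Fin.last r := Fin.ext (by simp [w]; omega)
  have : Nonempty (Fin r) := ⟨w⟩
  have hle : ∀ (f : Fin r → ℕ) (u : Fin r), f u ≤ ∑ u, e u * f u := fun f u =>
    (Nat.le_mul_of_pos_left _ (he1 u)).trans
      (Finset.single_le_sum (f := fun u => e u * f u) (fun _ _ => Nat.zero_le _)
        (Finset.mem_univ u))
  have hnu : ∀ u, nᵤ u ≤ n := fun u => hn ▸ hle nᵤ u
  have hmu : ∀ u, mᵤ u ≤ m := fun u => hm ▸ hle mᵤ u
  have hsu : ∀ u, sᵤ u ≤ s := fun u => hs ▸ hle sᵤ u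
  have hn1 : 1 ≤ n := (hP w).one_le_n.trans (hnu w)
  have hm1 : 1 ≤ m := (hP w).one_le_m.trans (hmu w)
  have hs1 : 1 ≤ s := (hsᵤ_pos w).trans (hsu w)
  have hβ0 : 0 < β := by
    rw [hβ]
    refine lt_min one_pos (div_pos (mul_pos ?_ ?_) ?_) <;> exact_mod_cast (by omega)
  -- the minimum distances
  have hδ1 : ∀ u, 1 ≤ δ' u := by
    intro u
    obtain ⟨x, -, y, -, hxy, hd⟩ := (hδ' u).1
    rw [← hd]
    exact hammingDist_pos.2 hxy
  have hδw : δ' w ≤ 1 := by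
    refine ((hδ' w).2 ⟨Pi.single ⟨0, hs'⟩ 1, by simp [hw, hN'_last], 0, zero_mem _, ?_, rfl⟩).trans
      ?_
    · simp
    · rw [hammingDist_zero_right, hammingNorm]
      refine Finset.card_le_one.2 fun i hi j hj => ?_
      simp only [Finset.mem_filter, Pi.single_apply, ne_eq, ite_eq_right_iff, not_forall] at hi hj
      exact hi.2.1.trans hj.2.1.symm
  have hδnorm : ∀ u, ∀ x ∈ N' u.succ, x ≠ 0 → δ' u ≤ hammingNorm x := fun u x hx hx0 =>
    (hδ' u).2 ⟨x, hx, 0, zero_mem _, hx0, hammingDist_zero_right x⟩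
  -- the parameter `t`
  set M : ℝ := ⨅ u : Fin r, ((⌊βᵤ u * nᵤ u⌋ : ℝ) - tᵤ u + 1) * δ' u
  have hMle : ∀ u, M ≤ ((⌊βᵤ u * nᵤ u⌋ : ℝ) - tᵤ u + 1) * δ' u := fun u =>
    ciInf_le (Set.finite_range _).bddBelow u
  have htu : ∀ u, (tᵤ u : ℝ) ≤ (⌊βᵤ u * nᵤ u⌋ : ℝ) := by
    intro u
    have : ((tᵤ u : ℤ) : ℤ) ≤ ⌊βᵤ u * nᵤ u⌋ := Int.le_floor.2 (by simpa using (hP u).t_le)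
    exact_mod_cast this
  -- This yields t ≤ βn.
  have hM1 : 1 ≤ M := by
    refine le_ciInf fun u => ?_
    have h1 := htu u
    have h2 : (1 : ℝ) ≤ δ' u := by exact_mod_cast hδ1 u
    nlinarith
  have hβn : ∀ u, βᵤ u * nᵤ u ≤ β * n := by
    intro u
    have hnu0 : (0 : ℝ) < nᵤ u := by exact_mod_cast (hP u).one_le_n
    have hn0 : (0 : ℝ) < n := by exact_mod_cast hn1
    have h1 := (hP u).beta_le.trans (min_le_left _ _)
    have h2 := (hP u).beta_le.trans (min_le_right _ _)
    rw [le_div_iff₀ hnu0] at h2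
    rw [hβ, min_mul_of_nonneg _ _ hn0.le, div_mul_cancel₀ _ hn0.ne', one_mul]
    refine le_min ?_ (h2.trans ?_)
    · refine (mul_le_of_le_one_left hnu0.le h1).trans ?_
      exact_mod_cast hnu u
    · exact_mod_cast Nat.mul_le_mul_left α (hmu u)
  -- The last space is everything, so its minimum distance is 1 and its term bounds `M`. Hence the
  -- argument of the natural floor defining t is nonnegative.
  have hMβ : M ≤ β * n + 1 := by
    have h1 := hMle w
    have h2 : (δ' w : ℝ) = 1 := by exact_mod_cast le_antisymm hδw (hδ1 w)
    have h3 := Int.floor_le (βᵤ w * nᵤ w)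
    have h4 := hβn w
    have h5 : (0 : ℝ) ≤ tᵤ w := Nat.cast_nonneg _
    rw [h2, mul_one] at h1
    linarith
  have ht1 := Nat.floor_le (sub_nonneg.2 hMβ)
  have ht2 := Nat.lt_floor_add_one (β * n + 1 - M)
  set t := ⌊β * n + 1 - M⌋₊
  -- linear algebra data
  have hchain : ∀ u : Fin r, N' u.castSucc ≤ N' u.succ := fun u =>
    (hN'_strict (Fin.castSucc_lt_succ (i := u))).le
  choose Ψ hΨ using fun u => Submodule.exists_linearMap_ker (hchain u) (he u)
  choose K hK using fun i : Fin s => exists_threshold hsᵤ_mono (i : ℕ)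
  choose S hScard hS using fun i : Fin s => (N' (K i)).exists_coordinate_complement
  -- Block `i` gets `e u` coordinates from each net having an `i`-th coordinate, so the blocks have
  -- ∑ e_u s_u = s coordinates altogether.
  have hcardS : ∀ i, (S i).card = ∑ u, if (i : ℕ) < sᵤ u then e u else 0 := by
    intro i
    have h1 := hScard i
    have h2 := finrank_chain hN'_zero he (Fin.last r)
    rw [hN'_last, finrank_top, Module.finrank_fin_fun] at h2
    rw [finrank_chain hN'_zero he] at h1
    have h3 : (∑ u, if (i : ℕ) < sᵤ u then e u else 0) +
        ∑ u : Fin r, (if (u : ℕ) < K i then e u else 0) = s' := by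
      rw [h2, ← Finset.sum_add_distrib]
      refine Finset.sum_congr rfl fun u _ => ?_
      have h4 := hK i u
      have h5 : (u : ℕ) < Fin.last r := u.2
      split_ifs <;> omega
    omega
  have hcardσ : Fintype.card (Fin s) = Fintype.card (Σ i, {j // j ∈ S i}) := by
    rw [Fintype.card_fin, Fintype.card_sigma]
    simp only [Fintype.card_coe, hcardS]
    rw [Finset.sum_comm, hs]
    refine Finset.sum_congr rfl fun u _ => ?_
    rw [← Finset.sum_filter, Finset.sum_const, smul_eq_mul, mul_comm, ← hs,
      Fin.card_filter_val_lt, min_eq_right (hsu u)]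
  let εσ := Fintype.equivOfCardEq hcardσ
  let H : Fin r → Type := fun u => Fin ((b ^ e u) ^ mᵤ u)
  have hcardH : Fintype.card (∀ u, H u) = b ^ m := by
    rw [Fintype.card_pi]
    simp only [H, Fintype.card_fin, ← pow_mul, Finset.prod_pow_eq_pow_sum, ← hm]
  let εH : Fin (b ^ m) ≃ ∀ u, H u := (Fintype.equivFinOfCardEq hcardH).symm
  let ε : Fin b ≃ F := (Fintype.equivFinOfCardEq hb).symm
  choose D hD using fun u => (hP u).exists_digits
    (Fintype.equivFinOfCardEq (α := Fin (e u) → F) (by simp [hb])).symm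
  obtain ⟨ψ, hψ⟩ : ∃ ψ : AddChar F ℂ, ψ ≠ 1 := by
    refine ⟨AddChar.FiniteField.primitiveChar_to_Complex F, fun h => ?_⟩
    have := AddChar.FiniteField.primitiveChar_to_Complex_isPrimitive F one_ne_zero
    exact this (by rw [h]; ext; simp)
  suffices hnet : ∀ I : (Σ i, {j // j ∈ S i}) → Finset (Fin n),
      ((∑ p, topSum α (I p) : ℕ) : ℝ) ≤ β * n - t →
      ∀ k : (Σ i, {j // j ∈ S i}) → Fin n → F, k ≠ 0 → (∀ p l, l ∉ I p → k p l = 0) →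
        ∑ h : ∀ u, H u, ψ (∑ p, ∑ l, k p l * combinedDigits Ψ D h p l) = 0 by
    obtain ⟨Q, hQ⟩ := exists_isHigherOrderNet_of_digits (t := t) hn1 hm1 hs1 hα hb2 hβ0 hβ.le
      (by linarith) ε εH εσ (combinedDigits Ψ D) fun I hI a => by
        rw [← hb, card_digits_mul_of_sum_addChar_eq_zero hψ _ I (hnet I hI) a, hcardH, hb]
    exact ⟨t, Q, ht1, hQ⟩
  intro I hI k hk hkI
  simp only [sum_mul_combinedDigits hsu hnu]
  obtain ⟨u, ⟨i, l, hiu, hil⟩, hweight⟩ := exists_mul_topSum_le hN'_last hΨ hδnorm hsᵤ_mono hK hS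
    α I hk hkI
  have hItot : ((∑ i, ∑ j, topSum α (I ⟨i, j⟩) : ℕ) : ℝ) <
      ((⌊βᵤ u * nᵤ u⌋ : ℝ) - tᵤ u + 1) * δ' u := by
    rw [← Fintype.sum_sigma' (fun i j => topSum α (I ⟨i, j⟩))]
    exact lt_of_le_of_lt hI (by linarith [hMle u])
  have hδ0 : (0 : ℝ) < δ' u := by exact_mod_cast hδ1 u
  -- No detected position falls into the zero padding: one beyond `nᵤ u` alone would weigh at least
  -- δ'_u (n_u + 1), which is too much. This ensures that `c` below is nonzero.
  have hsupp : ∀ (i : Fin s), (i : ℕ) < sᵤ u → ∀ l : Fin n,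
      Ψ u (blockVector k i l) ≠ 0 → (l : ℕ) < nᵤ u := by
    intro i hiu l hil
    by_contra hl
    have h1 := hweight i hiu n le_rfl {l} (by simpa using hil)
    rw [topSum_singleton hα] at h1
    have h2 := h1.trans (Finset.single_le_sum (f := fun i => ∑ j, topSum α (I ⟨i, j⟩))
      (fun _ _ => Nat.zero_le _) (Finset.mem_univ i))
    have h3 : ((δ' u : ℝ)) * ((l : ℕ) + 1) ≤ ((∑ i, ∑ j, topSum α (I ⟨i, j⟩) : ℕ) : ℝ) := by
      exact_mod_cast h2
    have h4 : ((nᵤ u : ℕ) : ℝ) ≤ (l : ℕ) := by exact_mod_cast not_lt.1 hl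
    have h5 := Int.floor_le (βᵤ u * nᵤ u)
    have h6 : βᵤ u * nᵤ u ≤ nᵤ u :=
      mul_le_of_le_one_left (Nat.cast_nonneg _) ((hP u).beta_le.trans (min_le_left _ _))
    have h7 : (0 : ℝ) ≤ tᵤ u := Nat.cast_nonneg _
    nlinarith
  let c : Fin (sᵤ u) → Fin (nᵤ u) → Fin (e u) → F := fun i l =>
    Ψ u (blockVector k (Fin.castLE (hsu u) i) (Fin.castLE (hnu u) l))
  let C : Fin (sᵤ u) → Finset (Fin (nᵤ u)) := fun i => Finset.univ.filter fun l => c i l ≠ 0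
  have hc : c ≠ 0 := fun h => hil
    (congrFun (congrFun h ⟨i, hiu⟩) ⟨l, hsupp i hiu l hil⟩)
  have hC : ((∑ i, topSum α (C i) : ℕ) : ℝ) ≤ βᵤ u * nᵤ u - tᵤ u := by
    have h1 : δ' u * ∑ i, topSum α (C i) ≤ ∑ i, ∑ j, topSum α (I ⟨i, j⟩) := by
      rw [Finset.mul_sum]
      refine (Finset.sum_le_sum fun i _ => hweight (Fin.castLE (hsu u) i) i.2 _ (hnu u) (C i)
        fun l hl => (Finset.mem_filter.1 hl).2).trans ?_
      refine (Finset.sum_map Finset.univ (Fin.castLEEmb (hsu u))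
        (fun i => ∑ j, topSum α (I ⟨i, j⟩))).symm.trans_le ?_
      exact Finset.sum_le_sum_of_subset (Finset.subset_univ _)
    have h2 : (δ' u : ℝ) * ((∑ i, topSum α (C i) : ℕ) : ℝ) ≤
        ((∑ i, ∑ j, topSum α (I ⟨i, j⟩) : ℕ) : ℝ) := by exact_mod_cast h1
    -- The weight is an integer, so this strict bound with the floor improves to ≤ ⌊β_u n_u⌋ - t_u.
    have h3 : ((∑ i, topSum α (C i) : ℕ) : ℝ) < (⌊βᵤ u * nᵤ u⌋ : ℝ) - tᵤ u + 1 := by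
      by_contra h
      nlinarith
    have h4 : ((∑ i, topSum α (C i) : ℕ) : ℤ) < ⌊βᵤ u * nᵤ u⌋ - tᵤ u + 1 := by exact_mod_cast h3
    have h5 : (((∑ i, topSum α (C i) : ℕ) : ℤ) : ℝ) ≤ ((⌊βᵤ u * nᵤ u⌋ - tᵤ u : ℤ) : ℝ) := by
      exact_mod_cast Int.lt_add_one_iff.1 h4
    have h6 := Int.floor_le (βᵤ u * nᵤ u)
    push_cast at h5 ⊢
    linarith
  have hzero : ∑ h : H u, ψ (∑ i, ∑ l, c i l ⬝ᵥ D u h i l) = 0 := by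
    refine sum_addChar_eq_zero_of_equidistributed hψ (D u) c hc C
      (fun i l hl => by simpa [C] using hl)
      ((b ^ e u) ^ mᵤ u / (b ^ e u) ^ (∑ i, (C i).card)) fun a => ?_
    exact (Nat.div_eq_of_eq_mul_left (by positivity) (hD u C hC a).symm).symm
  -- The components of `h` vary independently, so the sum over `h` becomes a product of sums, of
  -- which the `u`-th is zero.
  have hprod : ∀ h : ∀ u, H u, ψ (∑ u, ∑ i, ∑ l, Ψ u (blockVector k (Fin.castLE (hsu u) i)
      (Fin.castLE (hnu u) l)) ⬝ᵥ D u (h u) i l) = ∏ u, ψ (∑ i, ∑ l, Ψ u (blockVector k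
        (Fin.castLE (hsu u) i) (Fin.castLE (hnu u) l)) ⬝ᵥ D u (h u) i l) := fun h =>
    map_prod ψ.toMonoidHom _ _
  rw [Finset.sum_congr rfl fun h _ => hprod h, ← Fintype.piFinset_univ,
    ← Finset.prod_univ_sum (fun _ => Finset.univ) fun u (h : H u) => ψ (∑ i, ∑ l, Ψ u (blockVector k
        (Fin.castLE (hsu u) i) (Fin.castLE (hnu u) l)) ⬝ᵥ D u h i l)]
  exact Finset.prod_eq_zero (Finset.mem_univ u) hzero
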